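/- Identify each infinite subset of $\omega$ with its increasing enumeration, let $[\omega]^\omega$ and $\mathrm{Fin}$ be the families of all infinite and of all finite subsets of $\omega$, and let $\mathfrak d$ be the least cardinality of a set $D\subseteq[\omega]^\omega$ such that for every $a\in[\omega]^\omega$ there is $b\in D$ with $a(n)\le b(n)$ for all but finitely many $n$. For an infinite cardinal $\kappa$, a set $X\subseteq[\omega]^\omega$ is \emph{$\kappa$-fin-unbounded} if $|X|\ge\kappa$ and for every $d\in[\omega]^\omega$ there is $S\subseteq X$ with $|S|<\kappa$ such that for every finite $F\subseteq X\setminus S$ there are infinitely many $n$ with $\bigcup F\cap[d(n),d(n+1))=\emptyset$. A family $\mathcal U$ of subsets of a space $Z$ is an \emph{$\omega$-cover} of $Z$ if $Z\notin\mathcal U$ and every finite subset of $Z$ is contained in a member of $\mathcal U$; it is a \emph{$\gamma$-cover} of $Z$ if it is infinite and every point of $Z$ belongs to all but finitely many members of $\mathcal U$. Let $\Gamma$, $\Omega$ and $\Gamma_{\mathrm{Bor}}$ be the classes of open $\gamma$-covers, open $\omega$-covers and countable Borel $\gamma$-covers, respectively. A space $Z$ satisfies $\mathsf S_1(\mathcal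 A,\mathcal B)$ if for every sequence $\mathcal U_0,\mathcal U_1,\dots$ of covers of $Z$ from the class $\mathcal A$ there are $U_n\in\mathcal U_n$ ($n\in\omega$) such that $\{U_n : n\in\omega\}$ is a cover of $Z$ from the class $\mathcal B$. The \emph{Michael topology} on $P(\omega)$ is the topology in which the points of $\mathrm{Fin}$ have the same neighbourhoods as in the standard (Cantor space) topology and all points of $[\omega]^\omega$ are isolated. **Theorem.** Let $\kappa$ be an infinite regular cardinal with $\kappa\le\mathfrak d$, let $X\subseteq[\omega]^\omega$ be a $\kappa$-fin-unbounded set, let $k$ be a natural number, and let $Y$ be a set of reals (a space homeomorphic to a subspace of the Cantor space) satisfying $\mathsf S_1(\Gamma_{\mathrm{Bor}},\Gamma_{\mathrm{Bor}})$. Then: 1. the product space $(X\cup\mathrm{Fin})^k\times Y$, where each factor $X\cup\mathrm{Fin}$ carries the subspace topology inherited from the Michael topology on $P(\omega)$, satisfies $\mathsf S_1(\Gamma,\Omega)$; 2. the product space $(X\cup\mathrm{Fin})^k\times Y$, where each factor $X\cup\mathrm{Fin}$ carries the subspace topology inherited from the standard topology on $P(\omega)$, satisfies $\mathsf S_1(\Gamma,\Omega)$.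 -/

import Mathlib

open Set

/-! ### Covers and the selection principle `S₁(𝒜, ℬ)` -/

section Covers

variable {Z : Type*}

/-- `𝒰` is an `ω`-cover of `Z`: the whole space is not a member, and every finite subset of `Z` is
contained in a member. -/
def IsOmegaCover (𝒰 : Set (Set Z)) : Prop :=
  univ ∉ 𝒰 ∧ ∀ F : Set Z, F.Finite → ∃ U ∈ 𝒰, F ⊆ U

/-- `𝒰` is a `γ`-cover of `Z`: it is infinite, and every point belongs to all but finitely many
members. -/
def IsGammaCover (𝒰 : Set (Set Z)) : Prop :=
  𝒰.Infinite ∧ ∀ z : Z, {U ∈ 𝒰 | z ∉ U}.Finite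

/-- The class `Ω` of open `ω`-covers of the space `(Z, t)`. -/
def openOmega (t : TopologicalSpace Z) : Set (Set (Set Z)) :=
  {𝒰 | IsOmegaCover 𝒰 ∧ ∀ U ∈ 𝒰, @IsOpen Z t U}

/-- The class `Γ` of open `γ`-covers of the space `(Z, t)`. -/
def openGamma (t : TopologicalSpace Z) : Set (Set (Set Z)) :=
  {𝒰 | IsGammaCover 𝒰 ∧ ∀ U ∈ 𝒰, @IsOpen Z t U}

/-- The class `Γ_Bor` of countable Borel `γ`-covers of the space `(Z, t)`. -/
def borelGamma (t : TopologicalSpace Z) : Set (Set (Set Z)) :=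
  {𝒰 | 𝒰.Countable ∧ IsGammaCover 𝒰 ∧ ∀ U ∈ 𝒰, @MeasurableSet Z (@borel Z t) U}

/-- The selection principle `S₁(𝒜, ℬ)`, where `𝒜` and `ℬ` are the relevant families of covers of
`Z`: from every sequence of members of `𝒜` one can select one set each so that the family of the
selected sets belongs to `ℬ`. -/
def SelectOne (𝒜 ℬ : Set (Set (Set Z))) : Prop :=
  ∀ 𝒰 : ℕ → Set (Set Z), (∀ n, 𝒰 n ∈ 𝒜) →
    ∃ U : ℕ → Set Z, (∀ n, U n ∈ 𝒰 n) ∧ range U ∈ ℬ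

end Covers

/-- A set of reals: a space that is homeomorphic to a subspace of the Cantor space. -/
def IsSetOfReals (Y : Type*) [TopologicalSpace Y] : Prop :=
  ∃ f : Y → (ℕ → Bool), Topology.IsEmbedding f

/-! ### The power set of `ω` -/

/-- The family `Fin` of all finite subsets of `ω`. -/
def finSets : Set (Set ℕ) := {a | a.Finite}

/-- The family `[ω]^ω` of all infinite subsets of `ω`. -/
def infSets : Set (Set ℕ) := {a | a.Infinite}

open Classical in
/-- The standard topology of `P(ω)`: the topology of the Cantor space `{0, 1}^ω`, transported along
characteristic functions. -/
noncomputable abbrev cantorTopology : TopologicalSpace (Set ℕ) :=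
  TopologicalSpace.induced (fun (a : Set ℕ) (n : ℕ) => decide (n ∈ a)) inferInstance

/-- The Michael topology of `P(ω)`: the points of `Fin` keep their standard neighbourhoods and the
points of `[ω]^ω` are isolated, so that a set is open if and only if it is a standard neighbourhood
of each of its points that lies in `Fin`. -/
abbrev michaelTopology : TopologicalSpace (Set ℕ) where
  IsOpen U := ∀ a ∈ U, a ∈ finSets → U ∈ @nhds _ cantorTopology a
  isOpen_univ := fun _ _ _ => Filter.univ_mem
  isOpen_inter := fun _ _ hU hV a ha hf => Filter.inter_mem (hU a ha.1 hf) (hV a ha.2 hf)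
  isOpen_sUnion := fun _ h a ⟨U, hU, haU⟩ hf =>
    Filter.mem_of_superset (h U hU a haU hf) (subset_sUnion_of_mem hU)

/-- The product topology of `Z^k × Y`, where each factor `Z ⊆ P(ω)` carries the subspace topology
inherited from the topology `t` of `P(ω)`. -/
abbrev powerProdTopology (t : TopologicalSpace (Set ℕ)) (Z : Set (Set ℕ)) (k : ℕ)
    (Y : Type*) [TopologicalSpace Y] : TopologicalSpace ((Fin k → Z) × Y) :=
  letI : TopologicalSpace Z := TopologicalSpace.induced Subtype.val t
  inferInstance

/-! ### Dominating sets and `κ`-fin-unbounded sets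

An infinite subset of `ω` is identified with its increasing enumeration, so that the elements of
`[ω]^ω`, regarded as functions, are exactly the strictly increasing functions `ℕ → ℕ`. -/

/-- `D` is a dominating subset of `[ω]^ω` (in terms of increasing enumerations). -/
def IsDominating (D : Set (ℕ → ℕ)) : Prop :=
  (∀ b ∈ D, StrictMono b) ∧
    ∀ a : ℕ → ℕ, StrictMono a → ∃ b ∈ D, {n | ¬ a n ≤ b n}.Finite

/-- The dominating number `𝔡`: the minimal cardinality of a dominating subset of `[ω]^ω`. -/
noncomputable def dominatingNumber : Cardinal.{0} :=
  sInf {c | ∃ D : Set (ℕ → ℕ), IsDominating D ∧ Cardinal.mk D = c}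

/-- `x` omits infinitely many of the intervals `[d(n), d(n+1))`. -/
def OmitsInfinitelyMany (x : Set ℕ) (d : ℕ → ℕ) : Prop :=
  {n | x ∩ Ico (d n) (d (n + 1)) = ∅}.Infinite

/-- `X` is a `κ`-fin-unbounded subset of `[ω]^ω`. -/
def IsFinUnbounded (κ : Cardinal.{0}) (X : Set (Set ℕ)) : Prop :=
  X ⊆ infSets ∧ κ ≤ Cardinal.mk X ∧
    ∀ d : ℕ → ℕ, StrictMono d →
      ∃ S ⊆ X, Cardinal.mk S < κ ∧
        ∀ F : Set (Set ℕ), F.Finite → F ⊆ X \ S → OmitsInfinitelyMany (⋃₀ F) d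

/-!
Write `Z = X ∪ Fin`. Since every standard open set is Michael open and the selected sets are members
of the given covers, both parts follow from one selection argument for Michael open sets `U n m`,
where `(U n m)ₘ` enumerates infinitely many members of the `n`-th cover.

For a finite set `A` let `tubeSet (U n m) A j l` be the interior of the set of all `y` such that
`(q, y) ∈ U n m` for every `q ∈ Z^k` whose coordinates belong to `A` or omit `[j, l)`. There are only
finitely many tuples with coordinates in `A` or contained in `[0, j)`, so a tube argument shows that
`y` belongs to `tubeSet (U n m) A j l` for almost all `m` and suitable `l` (`exists_mem_tubeSet`).
The property `S₁(Γ_Bor, Γ_Bor)` of `Y` makes the choice of these `m` and `l` uniform in `y`, up to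
finitely many `n` (`exists_bound`, `exists_tube_bounds`): for each `A` there are `φ` and `ψ` such
that, for every `y` and almost all `n`, all `m ≥ φ n` satisfy `y ∈ tubeSet (U n m) A n (ψ n m)`.

Let `S` be a set with `|S| < κ`. As `κ ≤ 𝔡`, some `h` is not dominated by any of the functions `φ`
that belong to the finite sets `A ⊆ S`. For each such `A`, fin-unboundedness applied to a sequence
that runs fast through `{n | φ n ≤ h n}` gives an exceptional set of size less than `κ`, and by
regularity the union `S'` of `S` with all of these sets has size less than `κ`. Then `h` selects sets
that capture every finite subset of the product whose coordinates avoid `S' \ S`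
(`exists_selection_step`). The coordinates in `S' \ S` are the obstacle, and it disappears after `ω`
iterations: the sets `S₀ = ∅`, `Sᵢ₊₁ = Sᵢ'` increase, so a finite set of coordinates meets
`Sᵢ₊₁ \ Sᵢ` for only finitely many `i`, and it suffices to spend on each `i` its own infinite block of
the given sequence of covers (`exists_selection`).
-/

open Filter Topology

/-! ### Bounding Borel functions on spaces with `S₁(Γ_Bor, Γ_Bor)` -/

/-- A space with `S₁(Γ_Bor, Γ_Bor)` has only bounded Borel images in `ω^ω`. The Borel function is
given by its sublevel sets: `C n m` stands for the set of points whose `n`-th value is at most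
`m`. -/
lemma exists_bound {Y : Type*} [tY : TopologicalSpace Y]
    (hYS : SelectOne (borelGamma tY) (borelGamma tY)) (C : ℕ → ℕ → Set Y)
    (hC : ∀ n m, @MeasurableSet Y (borel Y) (C n m)) (hmono : ∀ n, Monotone (C n))
    (hcov : ∀ n y, ∃ m, y ∈ C n m) :
    ∃ b : ℕ → ℕ, ∀ y, ∀ᶠ n in atTop, y ∈ C n (b n) := by
  let _ : MeasurableSpace Y := borel Y
  set D : ℕ → ℕ → Set Y := fun n m => ⋂ i ∈ Iic n, C i m with hD
  have hDC : ∀ {n i m y}, i ≤ n → y ∈ D n m → y ∈ C i m := by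
    intro n i m y hi hy
    exact mem_iInter₂.1 hy i hi
  have hDmeas : ∀ n m, MeasurableSet (D n m) := fun n m =>
    MeasurableSet.biInter (to_countable _) fun i _ => hC i m
  have hDmono : ∀ n, Monotone (D n) := fun n a b hab =>
    iInter₂_mono fun i _ => hmono i hab
  have hDanti : ∀ {n n' m}, n ≤ n' → D n' m ⊆ D n m := by
    intro n n' m h y hy
    exact mem_iInter₂.2 fun i hi => hDC (le_trans hi h) hy
  have hDcov : ∀ n y, ∀ᶠ m in atTop, y ∈ D n m := by
    intro n y
    have : ∀ i ∈ Iic n, ∀ᶠ m in atTop, y ∈ C i m := by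
      intro i _
      obtain ⟨m, hm⟩ := hcov i y
      filter_upwards [eventually_ge_atTop m] with m' hm' using hmono i hm' hm
    filter_upwards [(eventually_all_finite (finite_Iic n)).2 this] with m hm
    exact mem_iInter₂.2 hm
  -- a row that contains `univ` has, up to repetition, finitely many members and is no `γ`-cover; such
  -- rows form an initial segment, and if it is proper then they can be skipped
  by_cases hall : ∀ n, ∃ m, D n m = univ
  · choose b hb using hall
    refine ⟨b, fun y => Eventually.of_forall fun n => hDC le_rfl ?_⟩
    rw [hb]; trivial
  push Not at hall
  obtain ⟨n₀, hn₀⟩ := hall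
  have hne : ∀ n m, D (n₀ + n) m ≠ univ := fun n m h =>
    hn₀ m (univ_subset_iff.1 (h ▸ hDanti (Nat.le_add_right n₀ n)))
  obtain ⟨V, hV, -, ⟨hVinf, hVγ⟩, -⟩ := hYS (fun n => range (D (n₀ + n))) (by
    intro n
    refine ⟨countable_range _, ⟨fun hfin => ?_, fun y => ?_⟩, ?_⟩
    · -- a finite increasing family that covers `Y` has `Y` itself as a member
      obtain ⟨_, ⟨m, rfl⟩, hm⟩ :=
        hfin.exists_maximal (range_nonempty _)
      refine hne n m (eq_univ_of_forall fun y => ?_)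
      obtain ⟨m', hm', hy⟩ := ((eventually_ge_atTop m).and (hDcov (n₀ + n) y)).exists
      exact hm (mem_range_self m') (hDmono _ hm') hy
    · obtain ⟨M, hM⟩ := eventually_atTop.1 (hDcov (n₀ + n) y)
      refine ((finite_Iio M).image (D (n₀ + n))).subset ?_
      rintro _ ⟨⟨m, rfl⟩, hy⟩
      exact ⟨m, not_le.1 fun h => hy (hM m h), rfl⟩
    · rintro _ ⟨m, rfl⟩
      exact hDmeas _ m)
  choose c hc using hV
  -- infinitely many distinct sets were selected, so some index set `I` enumerates them injectively
  obtain ⟨I, hI, hIinj⟩ : ∃ I : Set ℕ, I.Infinite ∧ InjOn V I := by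
    obtain ⟨I, -, hI⟩ := (surjOn_image V univ).exists_bijOn_subset
    refine ⟨I, fun hfin => hVinf ?_, hI.injOn⟩
    rw [← image_univ, ← hI.image_eq]
    exact hfin.image V
  -- as `D n m` decreases in `n`, a bound at the next element of `I` serves for `n`
  choose next hnext hle using fun n => hI.exists_gt n
  refine ⟨fun n => c (next n), fun y => ?_⟩
  have hfin : {i ∈ I | y ∉ V i}.Finite := by
    refine Finite.of_finite_image ((hVγ y).subset ?_) (hIinj.mono fun i hi => hi.1)
    rintro _ ⟨i, hi, rfl⟩
    exact ⟨mem_range_self i, hi.2⟩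
  obtain ⟨N, hN⟩ := hfin.bddAbove
  filter_upwards [eventually_ge_atTop N] with n hn
  have hy : y ∈ V (next n) := by
    by_contra h
    have := hN ⟨hnext n, h⟩
    have := hle n
    omega
  rw [← hc] at hy
  exact hDC (by have := hle n; omega) hy

/-! ### Tubes in the product `Z^k × Y` -/

lemma eventually_mem_of_mem_nhds_cantor {s : Set ℕ} {O : Set (Set ℕ)}
    (hO : O ∈ @nhds _ cantorTopology s) :
    ∀ᶠ l in atTop, ∀ z : Set ℕ, z ∩ Iio l = s ∩ Iio l → z ∈ O := by
  classical
  rw [nhds_induced, mem_comap] at hO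
  obtain ⟨T, hT, hTO⟩ := hO
  rw [nhds_pi, Filter.mem_pi] at hT
  obtain ⟨I, hI, t, ht, hsub⟩ := hT
  obtain ⟨N, hN⟩ := hI.bddAbove
  filter_upwards [eventually_gt_atTop N] with l hl z hz
  refine hTO (hsub fun i hi => ?_)
  have hil : i < l := (hN hi).trans_lt hl
  have hiff : i ∈ z ↔ i ∈ s := by
    have := Set.ext_iff.1 hz i
    simpa [hil] using this
  simpa [hiff] using mem_of_mem_nhds (ht i)

/-- A Michael open set contains, around each of its points `(p, y)`, a basic neighbourhood: infinite
coordinates of `p` are kept fixed, and finite ones are determined up to some `l`. -/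
lemma eventually_tube {Z : Set (Set ℕ)} {k : ℕ} {Y : Type*} [TopologicalSpace Y]
    {U : Set ((Fin k → Z) × Y)} (hU : IsOpen[powerProdTopology michaelTopology Z k Y] U)
    {p : Fin k → Z} {y : Y} (hp : (p, y) ∈ U) :
    ∀ᶠ l in atTop, ∀ᶠ y' in 𝓝 y, ∀ q : Fin k → Z,
      (∀ i, q i = p i ∨ ((p i).1.Finite ∧ (q i).1 ∩ Iio l = (p i).1 ∩ Iio l)) → (q, y') ∈ U := by
  let _ : TopologicalSpace Z := TopologicalSpace.induced Subtype.val michaelTopology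
  have h1 : U ∈ 𝓝 (p, y) := IsOpen.mem_nhds hU hp
  rw [nhds_prod_eq, mem_prod_iff] at h1
  obtain ⟨P, hP, V, hV, hPV⟩ := h1
  rw [nhds_pi, Filter.mem_pi'] at hP
  obtain ⟨I, t, ht, hsub⟩ := hP
  have key : ∀ i, ∀ᶠ l in atTop, ∀ z : Z,
      (z = p i ∨ ((p i).1.Finite ∧ z.1 ∩ Iio l = (p i).1 ∩ Iio l)) → z ∈ t i := by
    intro i
    have hti := ht i
    rw [@nhds_induced _ _ michaelTopology, mem_comap] at hti
    obtain ⟨O, hO, hOt⟩ := hti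
    obtain ⟨O', hO'O, hO', hpO'⟩ := (@mem_nhds_iff _ michaelTopology _ _).1 hO
    by_cases hf : (p i).1.Finite
    · filter_upwards [eventually_mem_of_mem_nhds_cantor (hO' _ hpO' hf)] with l hl z hz
      rcases hz with rfl | ⟨-, hz⟩
      · exact hOt (hO'O hpO')
      · exact hOt (hO'O (hl _ hz))
    · refine Eventually.of_forall fun l z hz => ?_
      rcases hz with rfl | ⟨h, -⟩
      · exact hOt (hO'O hpO')
      · exact absurd h hf
  filter_upwards [eventually_all.2 key] with l hl
  filter_upwards [hV] with y' hy' q hq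
  exact hPV ⟨hsub fun i _ => hl i _ (hq i), hy'⟩

/-- The open set of all `y` with a neighbourhood `V` such that `B^k × V ⊆ U`, where `B` consists of the
elements of `Z` that belong to `A` or omit the interval `[j, l)`. -/
def tubeSet {Z : Set (Set ℕ)} {k : ℕ} {Y : Type*} [TopologicalSpace Y]
    (U : Set ((Fin k → Z) × Y)) (A : Set (Set ℕ)) (j l : ℕ) : Set Y :=
  interior {y | ∀ q : Fin k → Z, (∀ i, (q i).1 ∈ A ∨ (q i).1 ∩ Ico j l = ∅) → (q, y) ∈ U}

lemma monotone_tubeSet {Z : Set (Set ℕ)} {k : ℕ} {Y : Type*} [TopologicalSpace Y]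
    (U : Set ((Fin k → Z) × Y)) (A : Set (Set ℕ)) (j : ℕ) : Monotone (tubeSet U A j) := by
  intro l l' hl
  refine interior_mono fun y hy q hq => hy q fun i => (hq i).imp_right fun h => ?_
  exact subset_empty_iff.1 (h ▸ inter_subset_inter_right _ (Ico_subset_Ico_right hl))

lemma finite_gridPoints {X : Set (Set ℕ)} {k : ℕ} {A : Set (Set ℕ)} (hA : A.Finite) (j : ℕ) :
    {p : Fin k → (X ∪ finSets : Set (Set ℕ)) | ∀ i, (p i).1 ∈ A ∪ 𝒫 (Iio j)}.Finite :=
  Finite.pi' fun _ => (hA.union (finite_Iio j).finite_subsets).preimage Subtype.val_injective.injOn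

/-- If `U` contains `(p, y)` for every tuple `p` of elements of `A` and subsets of `[0, j)`, then `y`
belongs to `tubeSet U A j l` for some `l`. -/
lemma exists_mem_tubeSet {X : Set (Set ℕ)} {k : ℕ} {Y : Type*} [TopologicalSpace Y]
    {U : Set ((Fin k → (X ∪ finSets : Set (Set ℕ))) × Y)}
    (hU : IsOpen[powerProdTopology michaelTopology (X ∪ finSets) k Y] U)
    {A : Set (Set ℕ)} (hA : A.Finite) {j : ℕ} {y : Y}
    (h : ∀ p : Fin k → (X ∪ finSets : Set (Set ℕ)),
      (∀ i, (p i).1 ∈ A ∪ 𝒫 (Iio j)) → (p, y) ∈ U) :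
    ∃ l, y ∈ tubeSet U A j l := by
  classical
  have hP := finite_gridPoints (X := X) (k := k) hA j
  have h1 := (eventually_all_finite hP).2 fun p hp => eventually_tube hU (h p hp)
  obtain ⟨l, hl, hjl⟩ := (h1.and (eventually_ge_atTop j)).exists
  refine ⟨l, mem_interior_iff_mem_nhds.2 ?_⟩
  filter_upwards [(eventually_all_finite hP).2 hl] with y' hy' q hq
  have hfin : ∀ i, ((q i).1 ∩ Iio j).Finite := fun i => (finite_Iio j).inter_of_right _
  -- truncating to `[0, j)` the coordinates outside `A` turns `q` into one of the finitely many `p`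
  refine hy' (fun i => if (q i).1 ∈ A then q i else ⟨(q i).1 ∩ Iio j, Or.inr (hfin i)⟩) ?_ q ?_
  · intro i
    split_ifs with hi
    · exact Or.inl hi
    · exact Or.inr inter_subset_right
  · intro i
    split_ifs with hi
    · exact Or.inl rfl
    · refine Or.inr ⟨hfin i, ?_⟩
      have h2 := (hq i).resolve_left hi
      ext x
      have h3 : x ∉ (q i).1 ∩ Ico j l := by rw [h2]; exact notMem_empty x
      simp only [mem_inter_iff, mem_Iio, mem_Ico] at h3 ⊢
      constructor
      · rintro ⟨a, b⟩
        exact ⟨⟨a, by by_contra hc; exact h3 ⟨a, by omega, b⟩⟩, b⟩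
      · rintro ⟨⟨a, -⟩, b⟩
        exact ⟨a, b⟩

/-- The tubes can be bounded uniformly in `y`, up to finitely many `n`. -/
lemma exists_tube_bounds {X : Set (Set ℕ)} {k : ℕ} {Y : Type*} [tY : TopologicalSpace Y]
    (hYS : SelectOne (borelGamma tY) (borelGamma tY))
    (U : ℕ → ℕ → Set ((Fin k → (X ∪ finSets : Set (Set ℕ))) × Y))
    (hU : ∀ n m, IsOpen[powerProdTopology michaelTopology (X ∪ finSets) k Y] (U n m))
    (hγ : ∀ n z, ∀ᶠ m in atTop, z ∈ U n m) {A : Set (Set ℕ)} (hA : A.Finite) :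
    ∃ (φ : ℕ → ℕ) (ψ : ℕ → ℕ → ℕ), ∀ y, ∀ᶠ n in atTop, ∀ m ≥ φ n,
      y ∈ tubeSet (U n m) A n (ψ n m) := by
  let _ : MeasurableSpace Y := borel Y
  have _ : BorelSpace Y := ⟨rfl⟩
  have hW : ∀ n m l, MeasurableSet (tubeSet (U n m) A n l) := fun n m l =>
    isOpen_interior.measurableSet
  have hev : ∀ n y, ∀ᶠ m in atTop, ∃ l, y ∈ tubeSet (U n m) A n l := by
    intro n y
    have := (eventually_all_finite (finite_gridPoints (X := X) (k := k) hA n)).2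
      fun p _ => hγ n (p, y)
    filter_upwards [this] with m hm using exists_mem_tubeSet (hU n m) hA hm
  obtain ⟨φ, hφ⟩ := exists_bound hYS
    (fun n m => ⋂ m' ∈ Ici m, ⋃ l, tubeSet (U n m') A n l)
    (fun n m => MeasurableSet.biInter (to_countable _) fun m' _ =>
      MeasurableSet.iUnion fun l => hW n m' l)
    (fun n m₁ m₂ h => biInter_mono (Ici_subset_Ici.2 h) fun _ _ => Subset.rfl)
    (fun n y => by
      obtain ⟨m, hm⟩ := eventually_atTop.1 (hev n y)
      exact ⟨m, mem_iInter₂.2 fun m' hm' => mem_iUnion.2 (hm m' hm')⟩)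
  -- `ψ` is a bound on a function of the pair `(n, m)`, which is coded by a single number `e`
  obtain ⟨b, hb⟩ := exists_bound hYS
    (fun e l => tubeSet (U e.unpair.1 e.unpair.2) A e.unpair.1 l ∪
      (⋃ l', tubeSet (U e.unpair.1 e.unpair.2) A e.unpair.1 l')ᶜ)
    (fun e l => (hW _ _ _).union (MeasurableSet.iUnion fun l' => hW _ _ l').compl)
    (fun e l₁ l₂ h => union_subset_union_left _ (monotone_tubeSet _ _ _ h))
    (fun e y => by
      by_cases hy : y ∈ ⋃ l', tubeSet (U e.unpair.1 e.unpair.2) A e.unpair.1 l'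
      · obtain ⟨l, hl⟩ := mem_iUnion.1 hy
        exact ⟨l, Or.inl hl⟩
      · exact ⟨0, Or.inr hy⟩)
  refine ⟨φ, fun n m => b (Nat.pair n m), fun y => ?_⟩
  obtain ⟨N, hN⟩ := eventually_atTop.1 (hb y)
  filter_upwards [hφ y, eventually_ge_atTop N] with n hn hNn m hm
  have h1 := hN (Nat.pair n m) (hNn.trans (Nat.left_le_pair n m))
  rw [Nat.unpair_pair] at h1
  exact h1.resolve_right fun h => h (mem_iInter₂.1 hn m hm)

/-! ### Functions that are not dominated -/

/-- Fewer than `𝔡` functions, not necessarily increasing, do not dominate all functions. -/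
lemma exists_not_dominated {ι : Type} (hι : Cardinal.mk ι < dominatingNumber) (φ : ι → ℕ → ℕ) :
    ∃ h : ℕ → ℕ, ∀ i, ∃ᶠ n in atTop, φ i n ≤ h n := by
  set D : Set (ℕ → ℕ) := range fun i n => ∑ j ∈ Finset.range (n + 1), (φ i j + 1) with hD
  have hlt : Cardinal.mk D < dominatingNumber := Cardinal.mk_range_le.trans_lt hι
  have hnot : ¬ IsDominating D := fun h =>
    notMem_of_lt_csInf hlt (OrderBot.bddBelow _) ⟨D, h, rfl⟩
  have hmono : ∀ b ∈ D, StrictMono b := by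
    rintro _ ⟨i, rfl⟩
    refine strictMono_nat_of_lt_succ fun n => ?_
    have := Finset.sum_range_succ (fun j => φ i j + 1) (n + 1)
    dsimp only
    omega
  unfold IsDominating at hnot
  push Not at hnot
  obtain ⟨a, -, ha⟩ := hnot hmono
  refine ⟨a, fun i => ?_⟩
  have h1 := Nat.frequently_atTop_iff_infinite.2 (ha _ (mem_range_self i))
  refine h1.mono fun n hn => ?_
  have h2 : φ i n + 1 ≤ ∑ j ∈ Finset.range (n + 1), (φ i j + 1) :=
    Finset.single_le_sum (f := fun j => φ i j + 1) (fun _ _ => Nat.zero_le _)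
      (Finset.self_mem_range_succ n)
  omega

lemma mk_finset_lt_of_lt {κ : Cardinal.{0}} (hκ : Cardinal.aleph0 ≤ κ) {α : Type}
    (hα : Cardinal.mk α < κ) : Cardinal.mk (Finset α) < κ := by
  cases finite_or_infinite α
  · exact (Cardinal.lt_aleph0_of_finite _).trans_le hκ
  · rwa [Cardinal.mk_finset_of_infinite]

lemma exists_strictMono_of_frequently {p : ℕ → Prop} (hp : ∃ᶠ n in atTop, p n) (f : ℕ → ℕ) :
    ∃ d : ℕ → ℕ, StrictMono d ∧ (∀ i, p (d i)) ∧ ∀ i, f (d i) ≤ d (i + 1) := by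
  choose g hg hpg using fun N => hp.forall_exists_of_atTop N
  refine ⟨fun i => Nat.rec (g 0) (fun _ x => g (max (x + 1) (f x))) i,
    strictMono_nat_of_lt_succ fun i => ?_, fun i => ?_, fun i => ?_⟩
  · exact (le_max_left _ _).trans (hg _)
  · cases i <;> exact hpg _
  · exact (le_max_right _ _).trans (hg _)

/-! ### The selection -/

/-- A selection that captures all finite sets whose coordinates avoid `S' \ S`. -/
lemma exists_selection_step {κ : Cardinal.{0}} (hκ : κ.IsRegular) (hκd : κ ≤ dominatingNumber)
    {X : Set (Set ℕ)} (hX : IsFinUnbounded κ X) {k : ℕ} {Y : Type*} [tY : TopologicalSpace Y]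
    (hYS : SelectOne (borelGamma tY) (borelGamma tY))
    (U : ℕ → ℕ → Set ((Fin k → (X ∪ finSets : Set (Set ℕ))) × Y))
    (hU : ∀ n m, IsOpen[powerProdTopology michaelTopology (X ∪ finSets) k Y] (U n m))
    (hγ : ∀ n z, ∀ᶠ m in atTop, z ∈ U n m)
    {S : Set (Set ℕ)} (hS : Cardinal.mk S < κ) :
    ∃ (h : ℕ → ℕ) (S' : Set (Set ℕ)), S ⊆ S' ∧ Cardinal.mk S' < κ ∧
      ∀ A : Set (Set ℕ), A.Finite → A ⊆ X ∪ finSets → Disjoint A (S' \ S) →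
      ∀ G : Set Y, G.Finite →
        ∃ n, ∀ q : Fin k → (X ∪ finSets : Set (Set ℕ)), (∀ i, (q i).1 ∈ A) →
          ∀ y ∈ G, (q, y) ∈ U n (h n) := by
  classical
  have hidx : Cardinal.mk (Finset S) < κ := mk_finset_lt_of_lt hκ.aleph0_le hS
  have hbase : ∀ B : Finset S, (Subtype.val '' (B : Set S)).Finite := fun B =>
    B.finite_toSet.image _
  choose φ ψ hφψ using fun B : Finset S => exists_tube_bounds hYS U hU hγ (hbase B)
  obtain ⟨h, hh⟩ := exists_not_dominated (hidx.trans_le hκd) φ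
  choose d hdmono hdφ hdψ using fun B : Finset S =>
    exists_strictMono_of_frequently (hh B) fun n => ψ B n (h n)
  choose T hTX hTκ hT using fun B : Finset S => hX.2.2 (d B) (hdmono B)
  refine ⟨h, S ∪ ⋃ B, T B, subset_union_left, ?_, ?_⟩
  · refine (Cardinal.mk_union_le _ _).trans_lt (Cardinal.add_lt_of_lt hκ.aleph0_le hS ?_)
    exact (Cardinal.card_iUnion_lt_iff_forall_of_isRegular hκ hidx).2 hTκ
  intro A hA hAX hAS G hG
  -- `B` is the set of coordinates in `S`, and `E` that of the remaining infinite ones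
  set B : Finset S := (hA.preimage Subtype.val_injective.injOn).toFinset with hB
  have hBmem : ∀ a (ha : a ∈ S), a ∈ A → a ∈ Subtype.val '' (B : Set S) := by
    intro a ha haA
    exact ⟨⟨a, ha⟩, by simpa [hB] using haA, rfl⟩
  set E : Set (Set ℕ) := {a ∈ A | a ∉ S ∧ a.Infinite} with hE
  have hEX : E ⊆ X \ T B := by
    rintro a ⟨haA, haS, hainf⟩
    refine ⟨(hAX haA).resolve_right fun hf => hainf hf, fun haT => ?_⟩
    exact disjoint_left.1 hAS haA ⟨Or.inr (mem_iUnion.2 ⟨B, haT⟩), haS⟩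
  have hinf := hT B E (hA.subset fun a ha => ha.1) hEX
  have hfinsets : ∀ᶠ n in atTop, ∀ a ∈ A, a.Finite → ∀ x ∈ a, x < n := by
    refine (eventually_all_finite hA).2 fun a _ => ?_
    by_cases ha : a.Finite
    · obtain ⟨N, hN⟩ := ha.bddAbove
      filter_upwards [eventually_gt_atTop N] with n hn _ x hx using (hN hx).trans_lt hn
    · exact Eventually.of_forall fun n h => absurd h ha
  have hev := (hdmono B).tendsto_atTop.eventually
    (hfinsets.and ((eventually_all_finite hG).2 fun y _ => hφψ B y))
  obtain ⟨i, hi, hifin, hiG⟩ := ((Nat.frequently_atTop_iff_infinite.2 hinf).and_eventually hev).exists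
  refine ⟨d B i, fun q hq y hy => ?_⟩
  refine interior_subset (monotone_tubeSet _ _ _ (hdψ B i) (hiG y hy _ (hdφ B i))) q fun c => ?_
  by_cases hcS : (q c).1 ∈ S
  · exact Or.inl (hBmem _ hcS (hq c))
  refine Or.inr (eq_empty_of_forall_notMem fun x hx => ?_)
  by_cases hcf : (q c).1.Finite
  · exact absurd (hifin _ (hq c) hcf x hx.1) (not_lt.2 hx.2.1)
  · have : x ∈ ⋃₀ E ∩ Ico (d B i) (d B (i + 1)) := ⟨⟨_, ⟨hq c, hcS, hcf⟩, hx.1⟩, hx.2⟩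
    rw [hi] at this
    exact this

/-- Members of an increasing sequence `S` of sets of size less than `κ` are used in turn, the `i`-th on
the covers with indices `Nat.pair i n`. -/
lemma exists_selection {κ : Cardinal.{0}} (hκ : κ.IsRegular) (hκd : κ ≤ dominatingNumber)
    {X : Set (Set ℕ)} (hX : IsFinUnbounded κ X) {k : ℕ} {Y : Type*} [tY : TopologicalSpace Y]
    (hYS : SelectOne (borelGamma tY) (borelGamma tY))
    (U : ℕ → ℕ → Set ((Fin k → (X ∪ finSets : Set (Set ℕ))) × Y))
    (hU : ∀ n m, IsOpen[powerProdTopology michaelTopology (X ∪ finSets) k Y] (U n m))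
    (hγ : ∀ n z, ∀ᶠ m in atTop, z ∈ U n m) :
    ∃ h : ℕ → ℕ, ∀ P : Set ((Fin k → (X ∪ finSets : Set (Set ℕ))) × Y), P.Finite →
      ∃ n, P ⊆ U n (h n) := by
  choose! h T hST hTκ hsel using fun (i : ℕ) (S : Set (Set ℕ)) (hS : Cardinal.mk S < κ) =>
    exists_selection_step hκ hκd hX hYS (fun n => U (Nat.pair i n)) (fun n => hU _)
      (fun n => hγ _) hS
  set S : ℕ → Set (Set ℕ) := fun i => Nat.rec ∅ T i with hSdef
  have hS : ∀ i, Cardinal.mk (S i) < κ := by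
    intro i
    induction i with
    | zero => simpa [hSdef] using hκ.pos
    | succ i ih => exact hTκ i _ ih
  have hSmono : Monotone S := monotone_nat_of_le_succ fun i => hST i _ (hS i)
  refine ⟨fun e => h e.unpair.1 (S e.unpair.1) e.unpair.2, fun P hP => ?_⟩
  set A : Set (Set ℕ) := ⋃ c : Fin k, (fun z => (z.1 c).1) '' P with hAdef
  have hA : A.Finite := finite_iUnion fun c => hP.image _
  -- each element of `A` lies in at most one of the differences `S (i + 1) \ S i`
  have hbad : ∀ᶠ i in atTop, ∀ a ∈ A, a ∉ S (i + 1) \ S i := by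
    refine (eventually_all_finite hA).2 fun a _ => ?_
    by_cases ha : ∃ i, a ∈ S i
    · obtain ⟨i, hi⟩ := ha
      filter_upwards [eventually_ge_atTop i] with j hj hmem using hmem.2 (hSmono hj hi)
    · exact Eventually.of_forall fun i hi => ha ⟨i + 1, hi.1⟩
  obtain ⟨i, hi⟩ := hbad.exists
  have hAX : A ⊆ X ∪ finSets := by
    refine iUnion_subset fun c => ?_
    rintro _ ⟨z, -, rfl⟩
    exact (z.1 c).2
  obtain ⟨n, hn⟩ := hsel i (S i) (hS i) A hA hAX (disjoint_left.2 hi) (Prod.snd '' P)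
    (hP.image _)
  refine ⟨Nat.pair i n, fun z hz => ?_⟩
  simp only [Nat.unpair_pair]
  exact hn z.1 (fun c => mem_iUnion.2 ⟨c, z, hz, rfl⟩) z.2 ⟨z, hz, rfl⟩

lemma michaelTopology_le_cantorTopology : michaelTopology ≤ cantorTopology := by
  intro U hU a ha _
  exact @IsOpen.mem_nhds _ cantorTopology a U hU ha

lemma powerProdTopology_mono {t t' : TopologicalSpace (Set ℕ)} (h : t ≤ t') (Z : Set (Set ℕ))
    (k : ℕ) (Y : Type*) [TopologicalSpace Y] :
    powerProdTopology t Z k Y ≤ powerProdTopology t' Z k Y :=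
  inf_le_inf (induced_mono (iInf_mono fun _ => induced_mono (induced_mono h))) le_rfl

/-- The selection principle for all topologies on `P(ω)` that are coarser than the Michael topology. -/
lemma selectOne_of_le_michael {κ : Cardinal.{0}} (hκ : κ.IsRegular) (hκd : κ ≤ dominatingNumber)
    {X : Set (Set ℕ)} (hX : IsFinUnbounded κ X) (k : ℕ) (Y : Type*) [tY : TopologicalSpace Y]
    (hYS : SelectOne (borelGamma tY) (borelGamma tY)) {t : TopologicalSpace (Set ℕ)}
    (ht : michaelTopology ≤ t) :
    SelectOne (openGamma (powerProdTopology t (X ∪ finSets) k Y))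
      (openOmega (powerProdTopology t (X ∪ finSets) k Y)) := by
  intro 𝒰 h𝒰
  -- `univ` may belong to a `γ`-cover, but not to an `ω`-cover, so it must not be selected
  have hinf : ∀ n, (𝒰 n \ {univ}).Infinite := fun n => (h𝒰 n).1.1.sdiff (finite_singleton _)
  let U := fun n m => ((hinf n).natEmbedding _ m).1
  have hUmem : ∀ n m, U n m ∈ 𝒰 n \ {univ} := fun n m => ((hinf n).natEmbedding _ m).2
  have hUinj : ∀ n, Function.Injective (U n) := fun n =>
    Subtype.val_injective.comp ((hinf n).natEmbedding _).injective
  obtain ⟨h, hh⟩ := exists_selection hκ hκd hX hYS U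
    (fun n m => powerProdTopology_mono ht _ _ _ _ ((h𝒰 n).2 _ (hUmem n m).1))
    (fun n z => by
      have hfin : {m | z ∉ U n m}.Finite :=
        (((h𝒰 n).1.2 z).preimage (hUinj n).injOn).subset fun m hm => ⟨(hUmem n m).1, hm⟩
      rw [← Nat.cofinite_eq_atTop]
      exact hfin)
  refine ⟨fun n => U n (h n), fun n => (hUmem n _).1, ⟨?_, fun F hF => ?_⟩, ?_⟩
  · rintro ⟨n, hn⟩
    exact (hUmem n _).2 hn
  · obtain ⟨n, hn⟩ := hh F hF
    exact ⟨_, mem_range_self n, hn⟩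
  · rintro _ ⟨n, rfl⟩
    exact (h𝒰 n).2 _ (hUmem n _).1

theorem mainTheorem1 (κ : Cardinal.{0}) (hκ : κ.IsRegular) (hκd : κ ≤ dominatingNumber)
    (X : Set (Set ℕ)) (hX : IsFinUnbounded κ X) (k : ℕ)
    (Y : Type*) [tY : TopologicalSpace Y] (hY : IsSetOfReals Y)
    (hYS : SelectOne (borelGamma tY) (borelGamma tY)) :
    SelectOne
        (openGamma (powerProdTopology michaelTopology (X ∪ finSets) k Y))
        (openOmega (powerProdTopology michaelTopology (X ∪ finSets) k Y)) ∧
      SelectOne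
        (openGamma (powerProdTopology cantorTopology (X ∪ finSets) k Y))
        (openOmega (powerProdTopology cantorTopology (X ∪ finSets) k Y)) :=
  ⟨selectOne_of_le_michael hκ hκd hX k Y hYS le_rfl,
    selectOne_of_le_michael hκ hκd hX k Y hYS michaelTopology_le_cantorTopology⟩
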